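/- For $m,\delta\in\mathbb N$, consider chains $\langle \alpha,A_1,\dots,A_\delta\rangle$ with $\alpha\in A_1\subseteq A_2\subseteq\cdots\subseteq A_\delta\subseteq[m]=\{1,\dots,m\}$. For integers $r,\sigma\ge 2$, let $W_r(m,\sigma,\delta)$ be the graph whose vertices are those chains with $|A_i|=r^{i-1}\cdot r^{\sigma}$ for all $1\le i\le\delta$, in which $\langle \alpha,A_1,\dots,A_\delta\rangle$ and $\langle \beta,B_1,\dots,B_\delta\rangle$ are adjacent if and only if $\alpha\ne\beta$, $\alpha\in B_1$, $\beta\in A_1$, and $A_i\subseteq B_{i+1}$, $B_i\subseteq A_{i+1}$ for all $1\le i\le\delta-1$. Let $\chi$ denote the chromatic number and $\log^{(j)}$ the base-2 logarithm iterated $j$ times. Then for all fixed integers $r,\sigma\ge 2$ and $\delta\ge 1$, $$\chi(W_r(m,\sigma,\delta)) > 2^{\frac{r^{\sigma+\delta-2}(r-1)-5}{2}}\,\log^{(2\delta)} m + o(1)\qquad\text{as } m\to\infty,$$ that is, there is a function $e:\mathbb N\to\mathbb R$ (depending on $r,\sigma,\delta$) with $e(m)\to 0$ as $m\to\infty$ such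 that $\chi(W_r(m,\sigma,\delta))>2^{(r^{\sigma+\delta-2}(r-1)-5)/2}\log^{(2\delta)}m+e(m)$ for all sufficiently large $m$. -/

import Mathlib

/-- A chain `⟨A₀, A₁, …, A_f⟩` of length `f` of subsets of an `m`-element universe (modelled by
`Fin m`): `A₀ ⊆ A₁ ⊆ ⋯ ⊆ A_f` with `A₀ = {α}` a singleton. Here `sets i` is `A_i` and `head`
is `α`. -/
structure SetChain (m f : ℕ) where
  head : Fin m
  sets : Fin (f + 1) → Finset (Fin m)
  sets_zero : sets 0 = {head}
  mono : Monotone sets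

/-- The graph on all chains of length `δ` in which `⟨α, A₁, …, A_δ⟩` and `⟨β, B₁, …, B_δ⟩` are
adjacent iff `α ≠ β`, `α ∈ B₁`, `β ∈ A₁`, and `A_i ⊆ B_{i+1}`, `B_i ⊆ A_{i+1}` for
`1 ≤ i ≤ δ - 1`. As `A₀ = {α}` and `B₀ = {β}`, the conditions `α ∈ B₁` and `β ∈ A₁` are the
inclusions `A₀ ⊆ B₁` and `B₀ ⊆ A₁`, that is, the case `i = 0` below. -/
def chainGraph (m δ : ℕ) : SimpleGraph (SetChain m δ) where
  Adj A B := A.head ≠ B.head ∧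
    ∀ i : Fin δ, A.sets i.castSucc ⊆ B.sets i.succ ∧ B.sets i.castSucc ⊆ A.sets i.succ
  symm := ⟨fun _ _ h => ⟨h.1.symm, fun i => (h.2 i).symm⟩⟩
  loopless := ⟨fun _ h => h.1 rfl⟩

/-- The vertices of `W_r(m, σ, δ)`: the chains `⟨α, A₁, …, A_δ⟩` with `|A_i| = r^(i-1) * r^σ` for
`1 ≤ i ≤ δ` (`j : Fin δ` stands for `i - 1`). -/
def wVertices (r m σ δ : ℕ) : Set (SetChain m δ) :=
  {A | ∀ j : Fin δ, (A.sets j.succ).card = r ^ (j : ℕ) * r ^ σ}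

/-- The chain graph `W_r(m, σ, δ)`. -/
def wGraph (r m σ δ : ℕ) : SimpleGraph (wVertices r m σ δ) :=
  (chainGraph m δ).induce (wVertices r m σ δ)

/-- The base-2 logarithm iterated `j` times. -/
noncomputable def iterLog (j : ℕ) (x : ℝ) : ℝ := (Real.logb 2)^[j] x

/-!
Write `δ = t + 1` and `D = r ^ (σ + δ - 2) * (r - 1)`, a lower bound for `|A_δ| - |A_{δ-1}|`. The
bound comes from a copy of a shift graph inside the chain graph and from the freedom to choose `D`
further elements of the last set.

Set aside a constant number `p` of padding elements. A strictly increasing tuple `x` of length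
`2 * t + 1` among the remaining `M = m - p` elements determines a chain of `t` sets above its middle
entry: the `i`-th set is the window of the entries at distance at most `i` from the middle, padded to
the prescribed size (`window`). If `y` arises from `x` by a shift (`IsShift`), then the windows of
`x` and `y` interlace as adjacency demands, and the largest windows differ by one element each way.

Given a proper colouring with `k` colours, put on each shift `(x, y)` the set `Z x y` of the colours
of the chains over `x` whose last set contains the largest window of `y`. Then `Z x y` and `Z y x`
are disjoint (`Extends.adj`), and since a chain over `x` has room for `D` further elements
(`exists_extends`), any `D` shifts into or out of `x` admit a colour that lies in the sets of the
outgoing ones and in none of the sets of the incoming ones.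

`exists_coloring_of_arc_sets` shows that a digraph with such arc sets has a proper colouring with
about `2 ^ 2 ^ (k / 2 ^ (D - 2))` colours (`arcBound_le`). Each arc set, or else its complement, has
at most half of the colours, so that every vertex, outside an independent set, can pay with one of
its `D` arcs for halving the set of colours; once two arcs are left, the vertex is coloured by the
family of its outgoing arc sets. As a shift graph on tuples of length `2 * t + 1` needs at least
`log^(2 * t) M` colours (`card_le_tower_of_shift_coloring`), it follows that `log^(2 * δ) m` is at
most `k / 2 ^ (D - 2)` up to lower order terms. The coefficient `2 ^ ((D - 5) / 2)` is smaller than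
`2 ^ (D - 2)` by a factor of at least `2 ^ (3 / 2)`, which absorbs the lower order terms, so the
error term can be taken to be `0` (`eventually_lt_of_le_tower`).
-/

/-! ### Shift graphs -/

/-- `tower n k` is `2 ^ 2 ^ ⋯ ^ k` with `n` twos. -/
def tower : ℕ → ℕ → ℕ
  | 0, k => k
  | n + 1, k => tower n (2 ^ k)

theorem tower_mono (n : ℕ) : Monotone (tower n) := by
  induction n with
  | zero => exact fun a b h => h
  | succ n ih => exact fun a b h => ih (Nat.pow_le_pow_right (by norm_num) h)

/-- The chromatic number of a shift graph on strictly increasing tuples of length `n + 1` is at least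
the `n`-fold logarithm of the size of the ground set. Tuples of length `n + 1` are coloured by the
sets of colours of their extensions by one entry, and `n` drops by one. -/
theorem card_le_tower_of_shift_coloring {M : ℕ} (n : ℕ) {γ : Type} [Fintype γ]
    (f : (Fin (n + 1) → Fin M) → γ)
    (hf : ∀ z : Fin (n + 2) → Fin M, StrictMono z → f (z ∘ Fin.castSucc) ≠ f (z ∘ Fin.succ)) :
    M ≤ tower n (Fintype.card γ) := by
  induction n generalizing γ with
  | zero =>
    have key : ∀ a b : Fin M, a < b → f (fun _ => a) ≠ f (fun _ => b) := by
      intro a b hab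
      have hz : StrictMono ![a, b] := by
        rw [Fin.strictMono_iff_lt_succ]
        intro i
        fin_cases i
        simpa using hab
      have := hf ![a, b] hz
      convert this using 2 <;> · funext i; fin_cases i; rfl
    have inj : Function.Injective (fun a : Fin M => f (fun _ => a)) := by
      intro a b hab
      by_contra hne
      rcases lt_or_gt_of_ne hne with h | h
      · exact key a b h hab
      · exact key b a h hab.symm
    simpa [tower] using Fintype.card_le_of_injective _ inj
  | succ n ih =>
    classical
    -- the colour set of a tuple collects the colours of its extensions by a last entry
    let f' : (Fin (n + 1) → Fin M) → Finset γ := fun x =>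
      Finset.univ.filter fun c => ∃ z, StrictMono z ∧ z ∘ Fin.castSucc = x ∧ f z = c
    have := ih f' (by
      intro z hz heq
      have h1 : f z ∈ f' (z ∘ Fin.castSucc) := by
        simp only [f', Finset.mem_filter, Finset.mem_univ, true_and]
        exact ⟨z, hz, rfl, rfl⟩
      rw [heq] at h1
      simp only [f', Finset.mem_filter, Finset.mem_univ, true_and] at h1
      obtain ⟨z', hz', h2, h3⟩ := h1
      -- `z` and `z'` overlap in all but one entry and glue to a longer increasing tuple
      have hcast : (Fin.cons (z 0) z' : Fin (n + 3) → Fin M) ∘ Fin.castSucc = z := by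
        funext i
        refine Fin.cases ?_ (fun j => ?_) i
        · rfl
        · have := congrFun h2 j
          simpa [Fin.castSucc_succ] using this
      refine hf (Fin.cons (z 0) z') ?_ ?_
      · rw [Fin.strictMono_iff_lt_succ]
        intro i
        have e := congrFun hcast i
        rw [Function.comp_apply] at e
        rw [e, Fin.cons_succ]
        refine Fin.cases ?_ (fun j => ?_) i
        · have e0 := congrFun h2 0
          simp only [Function.comp_apply, Fin.castSucc_zero] at e0
          rw [e0]
          exact hz (by simp)
        · have e1 := congrFun h2 j
          simp only [Function.comp_apply] at e1
          rw [← e1]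
          exact hz' (by simp [Fin.lt_def])
      · rw [hcast, ← h3]
        congr 1)
    simpa [tower] using this

/-! ### Digraphs with arc sets -/

/-- An upper bound for the chromatic number of a digraph whose arcs carry subsets of a `k`-element
set subject to the condition of `exists_coloring_of_arc_sets`. -/
def arcBound : ℕ → ℕ → ℕ
  | 0, k => 2 ^ 2 ^ k
  | d + 1, k => 1 + 2 ^ k * arcBound d (k / 2)

theorem arcBound_mono (d : ℕ) : Monotone (arcBound d) := by
  induction d with
  | zero => exact fun a b h => Nat.pow_le_pow_right (by norm_num) (Nat.pow_le_pow_right (by norm_num) h)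
  | succ d ih =>
    intro a b h
    have h1 := ih (Nat.div_le_div_right (c := 2) h)
    have h2 : 2 ^ a ≤ 2 ^ b := Nat.pow_le_pow_right (by norm_num) h
    simp only [arcBound]
    gcongr

theorem one_le_arcBound (d k : ℕ) : 1 ≤ arcBound d k := by
  cases d with
  | zero => exact Nat.one_le_two_pow
  | succ d => simp [arcBound]

/-- Suppose that the arcs `(v, w)` of the digraph `R` on `U` carry sets `Z v w` such that for any
at most `d + 2` arc sets at a vertex some element of `S` lies in the chosen outgoing sets `O` and
outside the chosen incoming sets `I`. Then the digraph has a proper colouring with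
`arcBound d S.card` colours. By induction on `d`: an outgoing set `Y` with `S ∩ Y` small, or an
incoming set `X` with `S \ X` small, can be used up to replace `S` by this smaller set. -/
theorem exists_coloring_of_arc_sets {V κ : Type} [Fintype κ] [DecidableEq κ]
    (R : V → V → Prop) (Z : V → V → Finset κ) (d : ℕ) (U : Set V) (S : Finset κ)
    (h : ∀ v ∈ U, ∀ O I : Finset (Finset κ), (∀ Y ∈ O, ∃ w ∈ U, R v w ∧ Z v w = Y) →
      (∀ X ∈ I, ∃ w ∈ U, R w v ∧ Z w v = X) → O.card + I.card ≤ d + 2 →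
      ∃ c ∈ S, (∀ Y ∈ O, c ∈ Y) ∧ ∀ X ∈ I, c ∉ X) :
    ∃ (γ : Type) (_ : Fintype γ) (f : V → γ), Fintype.card γ ≤ arcBound d S.card ∧
      ∀ v ∈ U, ∀ w ∈ U, R v w → f v ≠ f w := by
  classical
  induction d generalizing U S with
  | zero =>
    -- the colour of `v` is the family of the traces on `S` of its outgoing arc sets
    refine ⟨S.powerset.powerset, inferInstance,
      fun v => ⟨S.powerset.filter fun T => ∃ w ∈ U, R v w ∧ S ∩ Z v w = T,
        Finset.mem_powerset.2 (Finset.filter_subset _ _)⟩, ?_, ?_⟩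
    · rw [Fintype.card_coe, Finset.card_powerset, Finset.card_powerset, arcBound]
    · intro u hu v hv huv heq
      have heq := congrArg Subtype.val heq
      simp only at heq
      have hmem : S ∩ Z u v ∈ S.powerset.filter fun T => ∃ w ∈ U, R u w ∧ S ∩ Z u w = T :=
        Finset.mem_filter.2
          ⟨Finset.mem_powerset.2 Finset.inter_subset_left, v, hv, huv, rfl⟩
      rw [heq] at hmem
      obtain ⟨-, w, hw, hvw, e⟩ := Finset.mem_filter.1 hmem
      obtain ⟨c, hc, h1, h2⟩ := h v hv {Z v w} {Z u v}
        (by simpa using ⟨w, hw, hvw, rfl⟩) (by simpa using ⟨u, hu, huv, rfl⟩) (by simp)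
      have h1 : c ∈ Z v w := by simpa using h1
      have h2 : c ∉ Z u v := by simpa using h2
      have : c ∈ S ∩ Z u v := e ▸ Finset.mem_inter.2 ⟨hc, h1⟩
      exact h2 (Finset.mem_inter.1 this).2
  | succ d ih =>
    -- `P v T`: at the vertex `v`, one of the arcs can be used to restrict the colours to `T`
    let P : V → Finset κ → Prop := fun v T => T ⊆ S ∧ T.card ≤ S.card / 2 ∧
      ((∃ w ∈ U, R v w ∧ S ∩ Z v w = T) ∨ ∃ w ∈ U, R w v ∧ S \ Z w v = T)
    have hT : ∀ T : Finset κ, ∃ f : V → Fin (arcBound d (S.card / 2)),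
        ∀ v, v ∈ U → P v T → ∀ w, w ∈ U → P w T → R v w → f v ≠ f w := by
      intro T
      by_cases hTc : T.card ≤ S.card / 2
      · obtain ⟨γ, _, f, hcard, hf⟩ := ih {v | v ∈ U ∧ P v T} T (by
          rintro v ⟨hv, hTS, -, hP⟩ O I hO hI hOI
          rcases hP with ⟨w, hw, hvw, e⟩ | ⟨w, hw, hwv, e⟩
          · obtain ⟨c, hc, h1, h2⟩ := h v hv (insert (Z v w) O) I
              (by
                intro Y hY
                rcases Finset.mem_insert.1 hY with rfl | hY
                · exact ⟨w, hw, hvw, rfl⟩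
                · obtain ⟨u, hu, hu'⟩ := hO Y hY
                  exact ⟨u, hu.1, hu'⟩)
              (fun X hX => by
                obtain ⟨u, hu, hu'⟩ := hI X hX
                exact ⟨u, hu.1, hu'⟩)
              (by have := Finset.card_insert_le (Z v w) O; omega)
            refine ⟨c, ?_, fun Y hY => h1 Y (Finset.mem_insert_of_mem hY), h2⟩
            rw [← e]
            exact Finset.mem_inter.2 ⟨hc, h1 _ (Finset.mem_insert_self _ _)⟩
          · obtain ⟨c, hc, h1, h2⟩ := h v hv O (insert (Z w v) I)
              (fun X hX => by
                obtain ⟨u, hu, hu'⟩ := hO X hX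
                exact ⟨u, hu.1, hu'⟩)
              (by
                intro Y hY
                rcases Finset.mem_insert.1 hY with rfl | hY
                · exact ⟨w, hw, hwv, rfl⟩
                · obtain ⟨u, hu, hu'⟩ := hI Y hY
                  exact ⟨u, hu.1, hu'⟩)
              (by have := Finset.card_insert_le (Z w v) I; omega)
            refine ⟨c, ?_, h1, fun Y hY => h2 Y (Finset.mem_insert_of_mem hY)⟩
            rw [← e]
            exact Finset.mem_sdiff.2 ⟨hc, h2 _ (Finset.mem_insert_self _ _)⟩)
        have hle : Fintype.card γ ≤ Fintype.card (Fin (arcBound d (S.card / 2))) := by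
          simpa using hcard.trans (arcBound_mono d hTc)
        obtain ⟨g⟩ := Function.Embedding.nonempty_of_card_le hle
        exact ⟨fun v => g (f v), fun v hv hPv w hw hPw hvw e =>
          hf v ⟨hv, hPv⟩ w ⟨hw, hPw⟩ hvw (g.injective e)⟩
      · exact ⟨fun _ => ⟨0, one_le_arcBound _ _⟩, fun v _ hP => absurd hP.2.1 hTc⟩
    choose F hF using hT
    -- vertices without such a `T` share the colour `none`
    let f : V → Option (S.powerset × Fin (arcBound d (S.card / 2))) := fun v =>
      if hv : ∃ T, P v T then
        some (⟨hv.choose, Finset.mem_powerset.2 hv.choose_spec.1⟩, F hv.choose v)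
      else none
    refine ⟨_, inferInstance, f, ?_, ?_⟩
    · rw [Fintype.card_option, Fintype.card_prod, Fintype.card_coe, Finset.card_powerset,
        Fintype.card_fin, arcBound, add_comm]
    · intro u hu v hv huv heq
      by_cases hPu : ∃ T, P u T
      · by_cases hPv : ∃ T, P v T
        · simp only [f, dif_pos hPu, dif_pos hPv, Option.some.injEq, Prod.mk.injEq,
            Subtype.mk.injEq] at heq
          obtain ⟨e1, e2⟩ := heq
          have h1 := hPu.choose_spec
          have h2 := hPv.choose_spec
          rw [← e1] at h2 e2
          exact hF _ u hu h1 v hv h2 huv e2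
        · simp [f, dif_pos hPu, dif_neg hPv] at heq
      · by_cases hPv : ∃ T, P v T
        · simp [f, dif_neg hPu, dif_pos hPv] at heq
        · -- one of the two parts into which `Z u v` splits `S` has at most half of its elements
          have hc := Finset.card_inter_add_card_sdiff S (Z u v)
          rcases Nat.lt_or_ge (S.card / 2) (S ∩ Z u v).card with hlt | hle
          · exact hPv ⟨S \ Z u v, Finset.sdiff_subset, by omega, Or.inr ⟨u, hu, huv, rfl⟩⟩
          · exact hPu ⟨S ∩ Z u v, Finset.inter_subset_left, hle, Or.inl ⟨v, hv, huv, rfl⟩⟩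

theorem arcBound_le (d k : ℕ) :
    (arcBound d k : ℝ) ≤ 2 ^ ((2 : ℝ) ^ ((k : ℝ) / 2 ^ d) + d * (k + 1)) := by
  induction d generalizing k with
  | zero =>
    simp only [arcBound]
    push_cast
    rw [← Real.rpow_natCast 2 (2 ^ k)]
    simp
  | succ d ih =>
    simp only [arcBound]
    push_cast
    have hk : ((k / 2 : ℕ) : ℝ) ≤ (k : ℝ) / 2 := Nat.cast_div_le
    have h1 : (arcBound d (k / 2) : ℝ) ≤ 2 ^ ((2 : ℝ) ^ ((k : ℝ) / 2 ^ (d + 1)) + d * (k + 1)) := by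
      refine (ih (k / 2)).trans ?_
      refine Real.rpow_le_rpow_of_exponent_le (by norm_num) ?_
      refine add_le_add (Real.rpow_le_rpow_of_exponent_le (by norm_num) ?_) ?_
      · rw [pow_succ', ← div_div]
        gcongr
      · have : (0 : ℝ) ≤ k := Nat.cast_nonneg k
        exact mul_le_mul_of_nonneg_left (by linarith) (Nat.cast_nonneg d)
    set E : ℝ := (2 : ℝ) ^ ((k : ℝ) / 2 ^ (d + 1)) + d * (k + 1) with hE
    have hE0 : 0 ≤ E := by positivity
    have hone : (1 : ℝ) ≤ 2 ^ k * 2 ^ E :=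
      one_le_mul_of_one_le_of_one_le (one_le_pow₀ (by norm_num))
        (Real.one_le_rpow (by norm_num) hE0)
    calc (1 : ℝ) + 2 ^ k * (arcBound d (k / 2) : ℝ) ≤ 2 ^ k * 2 ^ E + 2 ^ k * 2 ^ E := by gcongr
      _ = 2 ^ ((1 : ℝ) + k + E) := by
        rw [Real.rpow_add (by norm_num) _ E, Real.rpow_add (by norm_num) 1, Real.rpow_one,
          Real.rpow_natCast]
        ring
      _ = _ := by
        congr 1
        rw [hE]
        ring

/-! ### Chains of windows -/

/-- The size of the `i`-th set of the chains in `wVertices`, including the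
singleton for `i = 0`. -/
def chainSize (r σ i : ℕ) : ℕ := if i = 0 then 1 else r ^ (i - 1) * r ^ σ

theorem chainSize_add_le (r σ i : ℕ) (hr : 2 ≤ r) (hσ : 2 ≤ σ) :
    chainSize r σ i + r ^ (σ + i - 1) * (r - 1) ≤ chainSize r σ (i + 1) := by
  obtain ⟨s, rfl⟩ : ∃ s, σ = s + 1 := ⟨σ - 1, by omega⟩
  obtain ⟨q, rfl⟩ : ∃ q, r = q + 1 := ⟨r - 1, by omega⟩
  rcases i with _ | i
  · have : 1 ≤ (q + 1) ^ s := Nat.one_le_pow _ _ (by omega)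
    simp only [chainSize, if_true, Nat.add_sub_cancel, add_zero, zero_add, one_ne_zero, if_false,
      pow_zero, one_mul, Nat.sub_self]
    rw [pow_succ]
    linarith [Nat.mul_add ((q + 1) ^ s) q 1]
  · have e : s + 1 + (i + 1) - 1 = i + (s + 1) := by omega
    simp only [chainSize, Nat.add_sub_cancel, Nat.succ_ne_zero, if_false, e]
    rw [pow_succ (q + 1) i, pow_add]
    exact le_of_eq (by ring)

theorem two_le_gap (r σ i : ℕ) (hr : 2 ≤ r) (hσ : 2 ≤ σ) : 2 ≤ r ^ (σ + i - 1) * (r - 1) := by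
  have h1 : r ^ 1 ≤ r ^ (σ + i - 1) := Nat.pow_le_pow_right (by omega) (by omega)
  have h2 : r ^ (σ + i - 1) * 1 ≤ r ^ (σ + i - 1) * (r - 1) := Nat.mul_le_mul_left _ (by omega)
  rw [pow_one] at h1
  omega

/-- The `i`-th set has room for the `2 * i + 1` entries of the `i`-th window. -/
theorem two_mul_add_one_le_chainSize (r σ i : ℕ) (hr : 2 ≤ r) (hσ : 2 ≤ σ) :
    2 * i + 1 ≤ chainSize r σ i := by
  induction i with
  | zero => simp [chainSize]
  | succ i ih =>
    have := chainSize_add_le r σ i hr hσ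
    have := two_le_gap r σ i hr hσ
    omega

theorem chainSize_mono (r σ : ℕ) (hr : 2 ≤ r) (hσ : 2 ≤ σ) : Monotone (chainSize r σ) :=
  monotone_nat_of_le_succ fun i => by
    have := chainSize_add_le r σ i hr hσ
    omega

/-- The `i`-th padded window of the tuple `x`: the entries of `x` at distance at most `i` from the
middle entry, together with as many of the `p` padding elements as are needed to have
`chainSize r σ i` elements. The universe `Fin (p + M)` consists of the `p` padding elements followed
by a copy of `Fin M`. -/
def window (p r σ : ℕ) {t M : ℕ} (x : Fin (2 * t + 1) → Fin M) (i : ℕ) : Finset (Fin (p + M)) :=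
  (Finset.univ.filter fun a : Fin p => (a : ℕ) < chainSize r σ i - (2 * i + 1)).map
      (Fin.castAddEmb M) ∪
    (Finset.univ.filter fun j : Fin (2 * t + 1) => t ≤ j + i ∧ (j : ℕ) ≤ t + i).image
      fun j => Fin.natAdd p (x j)

section Window

variable {p r σ t M : ℕ} {x y : Fin (2 * t + 1) → Fin M}

theorem mem_window {i : ℕ} {a : Fin (p + M)} :
    a ∈ window p r σ x i ↔
      (∃ b : Fin p, (b : ℕ) < chainSize r σ i - (2 * i + 1) ∧ Fin.castAdd M b = a) ∨
      ∃ j : Fin (2 * t + 1), (t ≤ j + i ∧ (j : ℕ) ≤ t + i) ∧ Fin.natAdd p (x j) = a := by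
  simp [window]

theorem card_window (hr : 2 ≤ r) (hσ : 2 ≤ σ) (hx : StrictMono x) {i : ℕ} (hi : i ≤ t)
    (hp : chainSize r σ i ≤ p) : (window p r σ x i).card = chainSize r σ i := by
  rw [window, Finset.card_union_of_disjoint, Finset.card_map, Finset.card_image_of_injective]
  · have h1 : (Finset.univ.filter fun j : Fin (2 * t + 1) => t ≤ j + i ∧ (j : ℕ) ≤ t + i).card
        = 2 * i + 1 := by
      rw [← Finset.card_map Fin.valEmbedding]
      have : (Finset.univ.filter fun j : Fin (2 * t + 1) => t ≤ j + i ∧ (j : ℕ) ≤ t + i).map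
          Fin.valEmbedding = Finset.Icc (t - i) (t + i) := by
        ext a
        simp only [Finset.mem_map, Finset.mem_filter, Finset.mem_univ, true_and,
          Fin.valEmbedding_apply, Finset.mem_Icc]
        constructor
        · rintro ⟨j, hj, rfl⟩
          omega
        · intro ha
          exact ⟨⟨a, by omega⟩, by simp only; omega, rfl⟩
      rw [this, Nat.card_Icc]
      omega
    have := two_mul_add_one_le_chainSize r σ i hr hσ
    rw [h1, Fin.card_filter_val_lt]
    omega
  · exact (Fin.natAdd_injective M p).comp hx.injective
  · rw [Finset.disjoint_left]
    intro a ha hb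
    simp only [Finset.mem_map, Finset.mem_image, Finset.mem_filter] at ha hb
    obtain ⟨b, -, rfl⟩ := ha
    obtain ⟨j, -, e⟩ := hb
    have := congrArg Fin.val e
    simp at this
    omega

/-- The number of padding elements used does not decrease along the windows. -/
theorem pad_mono (hr : 2 ≤ r) (hσ : 2 ≤ σ) :
    Monotone fun i => chainSize r σ i - (2 * i + 1) :=
  monotone_nat_of_le_succ fun i => by
    have := chainSize_add_le r σ i hr hσ
    have := two_le_gap r σ i hr hσ
    omega

theorem window_mono (hr : 2 ≤ r) (hσ : 2 ≤ σ) : Monotone (window p r σ x) := by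
  intro i i' hi a
  simp only [mem_window]
  rintro (⟨b, hb, e⟩ | ⟨j, hj, e⟩)
  · exact Or.inl ⟨b, hb.trans_le (pad_mono hr hσ hi), e⟩
  · exact Or.inr ⟨j, by omega, e⟩

theorem window_zero : window p r σ x 0 = {Fin.natAdd p (x ⟨t, by omega⟩)} := by
  ext a
  simp only [mem_window, Finset.mem_singleton]
  constructor
  · rintro (⟨b, hb, e⟩ | ⟨j, hj, e⟩)
    · simp [chainSize] at hb
    · have : j = ⟨t, by omega⟩ := Fin.ext (by simp only; omega)
      rw [← e, this]
  · rintro rfl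
    exact Or.inr ⟨_, by simp, rfl⟩

/-- The arcs of the shift digraph on the strictly increasing tuples: dropping the last, respectively
the first, entry of a strictly increasing tuple that is longer by one. -/
def IsShift {n M : ℕ} (x y : Fin (n + 1) → Fin M) : Prop :=
  ∃ z : Fin (n + 2) → Fin M, StrictMono z ∧ x = z ∘ Fin.castSucc ∧ y = z ∘ Fin.succ

theorem IsShift.apply_succ {n : ℕ} {x y : Fin (n + 1) → Fin M} (h : IsShift x y) {i j : Fin (n + 1)}
    (hij : (j : ℕ) = i + 1) : x j = y i := by
  obtain ⟨z, -, rfl, rfl⟩ := h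
  exact congrArg z (Fin.ext (by simpa using hij))

theorem IsShift.apply_lt {n : ℕ} {x y : Fin (n + 1) → Fin M} (h : IsShift x y) (i : Fin (n + 1)) :
    x i < y i := by
  obtain ⟨z, hz, rfl, rfl⟩ := h
  exact hz (by simp [Fin.lt_def])

theorem IsShift.window_subset_left (hr : 2 ≤ r) (hσ : 2 ≤ σ) (h : IsShift x y) {i : ℕ}
    (hi : i < t) : window p r σ x i ⊆ window p r σ y (i + 1) := by
  intro a
  simp only [mem_window]
  rintro (⟨b, hb, e⟩ | ⟨j, hj, e⟩)
  · exact Or.inl ⟨b, hb.trans_le (pad_mono hr hσ i.le_succ), e⟩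
  · refine Or.inr ⟨⟨j - 1, by omega⟩, by simp only; omega, ?_⟩
    rw [← e, h.apply_succ (i := ⟨j - 1, by omega⟩) (j := j) (by simp only; omega)]

theorem IsShift.window_subset_right (hr : 2 ≤ r) (hσ : 2 ≤ σ) (h : IsShift x y) {i : ℕ}
    (hi : i < t) : window p r σ y i ⊆ window p r σ x (i + 1) := by
  intro a
  simp only [mem_window]
  rintro (⟨b, hb, e⟩ | ⟨j, hj, e⟩)
  · exact Or.inl ⟨b, hb.trans_le (pad_mono hr hσ i.le_succ), e⟩
  · refine Or.inr ⟨⟨j + 1, by omega⟩, by simp only; omega, ?_⟩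
    rw [← e, h.apply_succ (i := j) (j := ⟨j + 1, by omega⟩) rfl]

theorem IsShift.window_left_subset_insert (h : IsShift x y) :
    window p r σ x t ⊆ insert (Fin.natAdd p (x 0)) (window p r σ y t) := by
  intro a
  simp only [Finset.mem_insert, mem_window]
  rintro (⟨b, hb, e⟩ | ⟨j, hj, e⟩)
  · exact Or.inr (Or.inl ⟨b, hb, e⟩)
  · rcases Nat.eq_zero_or_pos (j : ℕ) with h0 | h0
    · left
      rw [← e, show j = 0 from Fin.ext h0]
    · refine Or.inr (Or.inr ⟨⟨j - 1, by omega⟩, by simp only; omega, ?_⟩)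
      rw [← e, h.apply_succ (i := ⟨j - 1, by omega⟩) (j := j) (by simp only; omega)]

theorem IsShift.window_right_subset_insert (h : IsShift x y) :
    window p r σ y t ⊆ insert (Fin.natAdd p (y (Fin.last _))) (window p r σ x t) := by
  intro a
  simp only [Finset.mem_insert, mem_window]
  rintro (⟨b, hb, e⟩ | ⟨j, hj, e⟩)
  · exact Or.inr (Or.inl ⟨b, hb, e⟩)
  · rcases Nat.eq_or_lt_of_le (Nat.le_of_lt_succ j.2) with h0 | h0
    · left
      rw [← e, show j = Fin.last _ from Fin.ext h0]
    · refine Or.inr (Or.inr ⟨⟨j + 1, by omega⟩, by simp only; omega, ?_⟩)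
      rw [← e, h.apply_succ (i := j) (j := ⟨j + 1, by omega⟩) rfl]

/-- The chain `v` extends the chain of windows of the tuple `x` by one more set. -/
def Extends (r σ : ℕ) (v : SetChain (p + M) (t + 1)) (x : Fin (2 * t + 1) → Fin M) : Prop :=
  ∀ i : Fin (t + 1), v.sets i.castSucc = window p r σ x i

theorem Extends.head_eq {v : SetChain (p + M) (t + 1)} (h : Extends r σ v x) :
    v.head = Fin.natAdd p (x ⟨t, by omega⟩) := by
  have h0 := h 0
  rw [Fin.castSucc_zero, v.sets_zero, Fin.val_zero, window_zero] at h0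
  exact Finset.singleton_injective h0

/-- The chains over the two ends of a shift are adjacent as soon as their last sets contain the
largest window of the other end; the remaining inclusions hold for all windows. -/
theorem Extends.adj (hr : 2 ≤ r) (hσ : 2 ≤ σ) {v w : SetChain (p + M) (t + 1)}
    (hv : Extends r σ v x) (hw : Extends r σ w y) (h : IsShift x y)
    (hvy : window p r σ y t ⊆ v.sets (Fin.last _)) (hwx : window p r σ x t ⊆ w.sets (Fin.last _)) :
    (chainGraph (p + M) (t + 1)).Adj v w := by
  refine ⟨?_, fun i => ?_⟩
  · rw [hv.head_eq, hw.head_eq]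
    exact fun e => (h.apply_lt _).ne (Fin.natAdd_injective M p e)
  · refine Fin.lastCases ?_ (fun i => ?_) i
    · rw [hv, hw, Fin.succ_last]
      exact ⟨hwx, hvy⟩
    · rw [hv, hw, Fin.succ_castSucc, hv, hw]
      exact ⟨h.window_subset_left hr hσ i.2, h.window_subset_right hr hσ i.2⟩

/-- Beyond the largest window, the last set of a chain has room for `r ^ (σ + t - 1) * (r - 1)`
elements of free choice. -/
theorem exists_extends (hr : 2 ≤ r) (hσ : 2 ≤ σ) (hx : StrictMono x)
    (hp : chainSize r σ (t + 1) ≤ p) (E : Finset (Fin (p + M)))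
    (hE : E.card ≤ r ^ (σ + t - 1) * (r - 1)) :
    ∃ v ∈ wVertices r (p + M) σ (t + 1), Extends r σ v x ∧
      window p r σ x t ∪ E ⊆ v.sets (Fin.last _) := by
  have hcard : ∀ i ≤ t, (window p r σ x i).card = chainSize r σ i := fun i hi =>
    card_window hr hσ hx hi ((chainSize_mono r σ hr hσ (by omega)).trans hp)
  have hle : (window p r σ x t ∪ E).card ≤ chainSize r σ (t + 1) := by
    have h1 := Finset.card_union_le (window p r σ x t) E
    rw [hcard t le_rfl] at h1
    have h2 := chainSize_add_le r σ t hr hσ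
    omega
  obtain ⟨A, hA, -, hAc⟩ := Finset.exists_subsuperset_card_eq
    (Finset.subset_univ (window p r σ x t ∪ E)) hle (by simp; omega)
  let S : Fin (t + 2) → Finset (Fin (p + M)) :=
    Fin.snoc (fun i : Fin (t + 1) => window p r σ x i) A
  have hS : ∀ i : Fin (t + 1), S i.castSucc = window p r σ x i := fun i => by simp [S]
  have hSl : S (Fin.last _) = A := by simp [S]
  have hmono : Monotone S := by
    rw [Fin.monotone_iff_le_succ]
    intro i
    refine Fin.lastCases ?_ (fun i => ?_) i
    · rw [hS, Fin.succ_last, hSl]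
      exact Finset.union_subset_left hA
    · rw [hS, Fin.succ_castSucc, hS]
      exact window_mono hr hσ (by simp)
  refine ⟨⟨Fin.natAdd p (x ⟨t, by omega⟩), S, ?_, hmono⟩, ?_, hS, ?_⟩
  · have := hS 0
    rw [Fin.castSucc_zero] at this
    rw [this, Fin.val_zero, window_zero]
  · intro j
    have key : (S j.succ).card = chainSize r σ (j + 1) := by
      refine Fin.lastCases ?_ (fun i => ?_) j
      · rw [Fin.succ_last, hSl, hAc, Fin.val_last]
      · rw [Fin.succ_castSucc, hS, hcard _ (by simp)]
        simp
    simpa [chainSize] using key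
  · simpa only [hSl] using hA

end Window

instance SetChain.finite (m f : ℕ) : Finite (SetChain m f) := by
  refine Finite.of_injective
    (fun A : SetChain m f => (A.head, A.sets)) fun A B h => ?_
  cases A
  cases B
  simpa using h

/-- A proper colouring of the chain graph with `k` colours yields arc sets on the shift graph, and
thus a bound for the size of the universe. -/
theorem card_le_tower_of_colorable {r σ t p M d k : ℕ} (hr : 2 ≤ r) (hσ : 2 ≤ σ)
    (hp : chainSize r σ (t + 1) ≤ p) (hd : d + 2 = r ^ (σ + t - 1) * (r - 1))
    (hk : (wGraph r (p + M) σ (t + 1)).Colorable k) :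
    M ≤ tower (2 * t) (arcBound d k) := by
  classical
  obtain ⟨col⟩ := hk
  let Z : (Fin (2 * t + 1) → Fin M) → (Fin (2 * t + 1) → Fin M) → Finset (Fin k) := fun x y =>
    Finset.univ.filter fun c => ∃ v : wVertices r (p + M) σ (t + 1),
      Extends r σ v.1 x ∧ window p r σ y t ⊆ v.1.sets (Fin.last _) ∧ col v = c
  have hZ : ∀ x y c, c ∈ Z x y ↔ ∃ v : wVertices r (p + M) σ (t + 1),
      Extends r σ v.1 x ∧ window p r σ y t ⊆ v.1.sets (Fin.last _) ∧ col v = c :=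
    fun x y c => by simp [Z]
  obtain ⟨γ, _, f, hcard, hf⟩ := exists_coloring_of_arc_sets IsShift Z d {x | StrictMono x}
    Finset.univ (by
      intro x hx O I hO hI hOI
      have : Nonempty (Fin (2 * t + 1) → Fin M) := ⟨x⟩
      choose! o _ ho hoZ using hO
      choose! w _ hw hwZ using hI
      -- the last set of `v` receives the one new element that each chosen neighbour contributes
      obtain ⟨v, hvW, hv, hvE⟩ := exists_extends (p := p) hr hσ hx hp
        (O.image (fun Y => Fin.natAdd p (o Y (Fin.last _))) ∪ I.image fun X => Fin.natAdd p (w X 0))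
        (by
          rw [← hd]
          refine (Finset.card_union_le _ _).trans (le_trans ?_ hOI)
          exact add_le_add Finset.card_image_le Finset.card_image_le)
      have hvx := (Finset.union_subset_left hvE)
      have hvO := (Finset.union_subset_left (Finset.union_subset_right hvE))
      have hvI := (Finset.union_subset_right (Finset.union_subset_right hvE))
      refine ⟨col ⟨v, hvW⟩, Finset.mem_univ _, fun Y hY => ?_, fun X hX hc => ?_⟩
      · rw [← hoZ Y hY, hZ]
        refine ⟨⟨v, hvW⟩, hv, (ho Y hY).window_right_subset_insert.trans ?_, rfl⟩
        exact Finset.insert_subset (hvO (Finset.mem_image_of_mem _ hY)) hvx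
      · rw [← hwZ X hX, hZ] at hc
        obtain ⟨u, hu, hux, e⟩ := hc
        refine col.valid (v := u) (w := ⟨v, hvW⟩) ?_ e
        refine hu.adj hr hσ hv (hw X hX) hux ((hw X hX).window_left_subset_insert.trans ?_)
        exact Finset.insert_subset (hvI (Finset.mem_image_of_mem _ hX)) hvx)
  refine (card_le_tower_of_shift_coloring (2 * t) f fun z hz => ?_).trans
    (tower_mono _ (by simpa using hcard))
  exact hf _ (hz.comp Fin.strictMono_castSucc) _ (hz.comp Fin.strictMono_succ) ⟨z, hz, rfl, rfl⟩

/-! ### Asymptotics of the iterated logarithm -/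

theorem iterLog_succ (j : ℕ) (x : ℝ) : iterLog (j + 1) x = Real.logb 2 (iterLog j x) := by
  simp only [iterLog, Function.iterate_succ_apply']

theorem tendsto_iterLog (j : ℕ) :
    Filter.Tendsto (iterLog j) Filter.atTop Filter.atTop := by
  induction j with
  | zero => exact Filter.tendsto_id
  | succ j ih =>
    have : iterLog (j + 1) = Real.logb 2 ∘ iterLog j := funext (iterLog_succ j)
    rw [this]
    exact (Real.tendsto_logb_atTop (by norm_num)).comp ih

/-- Positivity of the intermediate iterates keeps the logarithm away from its junk values. -/
theorem iterLog_le_of_le_tower (j : ℕ) {x : ℝ} (hpos : ∀ i < j, 0 < iterLog i x) {G : ℕ}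
    (hG : 1 ≤ G) (hx : x ≤ 2 * (tower j G : ℝ)) : iterLog j x ≤ 2 * (G : ℝ) := by
  induction j generalizing G with
  | zero => exact hx
  | succ j ih =>
    have h1 := ih (fun i hi => hpos i (by omega)) (G := 2 ^ G) Nat.one_le_two_pow hx
    rw [iterLog_succ]
    have hG' : (1 : ℝ) ≤ G := by exact_mod_cast hG
    calc Real.logb 2 (iterLog j x) ≤ Real.logb 2 (2 * ((2 ^ G : ℕ) : ℝ)) :=
          Real.logb_le_logb_of_le (by norm_num) (hpos j (by omega)) h1
      _ = 1 + G := by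
          push_cast
          rw [Real.logb_mul (by norm_num) (by positivity), Real.logb_self_eq_one (by norm_num),
            Real.logb_pow, Real.logb_self_eq_one (by norm_num), mul_one]
      _ ≤ 2 * G := by linarith

theorem eventually_affine_lt_two_rpow (a b : ℝ) :
    ∀ᶠ L : ℝ in Filter.atTop, 2 ^ (L / 2) + a * L + b < (2 : ℝ) ^ L := by
  have hlog : 0 < Real.log 2 := Real.log_pos (by norm_num)
  have e : ∀ c L : ℝ, (2 : ℝ) ^ (c * L) = Real.exp ((Real.log 2 * c) * L) := by
    intro c L
    rw [Real.rpow_def_of_pos (by norm_num)]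
    ring_nf
  have t : Filter.Tendsto (fun L : ℝ => (2 : ℝ) ^ (L / 2)) Filter.atTop Filter.atTop :=
    by
    simp only [Real.rpow_def_of_pos (show (0 : ℝ) < 2 by norm_num)]
    exact Real.tendsto_exp_atTop.comp
      ((Filter.tendsto_id.atTop_div_const (by norm_num)).const_mul_atTop hlog)
  have lin : (fun L : ℝ => a * L + b) =o[Filter.atTop] fun L : ℝ => (2 : ℝ) ^ (L / 2) := by
    have h1 : (fun L : ℝ => L) =o[Filter.atTop] fun L : ℝ => (2 : ℝ) ^ (L / 2) := by
      have := isLittleO_pow_exp_pos_mul_atTop 1 (b := Real.log 2 * (1 / 2)) (by positivity)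
      simp only [pow_one] at this
      refine this.congr_right fun L => ?_
      rw [← e]
      ring_nf
    exact (h1.const_mul_left a).add (Asymptotics.isLittleO_const_left.2
      (Or.inr (tendsto_norm_atTop_atTop.comp t)))
  filter_upwards [lin.bound (show (0 : ℝ) < 1 by norm_num), t.eventually_gt_atTop 2] with L h1 h2
  have h3 : (2 : ℝ) ^ L = 2 ^ (L / 2) * 2 ^ (L / 2) := by
    rw [← Real.rpow_add (by norm_num)]
    ring_nf
  have h4 := (le_abs_self _).trans h1
  rw [one_mul, Real.norm_of_nonneg (by positivity)] at h4
  rw [h3]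
  nlinarith

/-- If `m` exceeds a tower over `arcBound d k` by a bounded amount only, then `k` is large. With
`L = iterLog (j + 2) m`, a bound `k ≤ c * L` would give `2 ^ L ≤ 2 ^ (L / 2) + O(L)`. -/
theorem eventually_lt_of_le_tower (j d p : ℕ) :
    ∀ᶠ m : ℕ in Filter.atTop, ∀ k M : ℕ, m = p + M → M ≤ tower j (arcBound d k) →
      (2 : ℝ) ^ (((d : ℝ) + 2 - 5) / 2) * iterLog (j + 2) (m : ℝ) < (k : ℝ) := by
  set c : ℝ := (2 : ℝ) ^ (((d : ℝ) + 2 - 5) / 2) with hc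
  have hc0 : 0 < c := by positivity
  have hcast : Filter.Tendsto (fun m : ℕ => (m : ℝ)) Filter.atTop Filter.atTop :=
    tendsto_natCast_atTop_atTop
  have hpos : ∀ i : ℕ, ∀ᶠ m : ℕ in Filter.atTop, 0 < iterLog i (m : ℝ) := fun i =>
    ((tendsto_iterLog i).comp hcast).eventually_gt_atTop 0
  have hall : ∀ᶠ m : ℕ in Filter.atTop, ∀ i ∈ Finset.range (j + 3), 0 < iterLog i (m : ℝ) :=
    (Filter.eventually_all_finset _).2 fun i _ => hpos i
  filter_upwards [hall, Filter.eventually_ge_atTop (2 * p),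
    ((tendsto_iterLog (j + 2)).comp hcast).eventually
      (eventually_affine_lt_two_rpow (d * c) (d + 1))] with m hm hmp hL k M hmM hM
  by_contra hk
  rw [not_lt] at hk
  have hp : ∀ i < j + 3, 0 < iterLog i (m : ℝ) := fun i hi => hm i (Finset.mem_range.2 hi)
  simp only [Function.comp_apply] at hL
  -- for `m ≥ 2 * p` the shift by `p` costs a factor of at most two
  have h2M : (m : ℝ) ≤ 2 * (tower j (arcBound d k) : ℝ) := by
    have : m ≤ 2 * tower j (arcBound d k) := by omega
    exact_mod_cast this
  have h1 := iterLog_le_of_le_tower j (fun i hi => hp i (by omega)) (one_le_arcBound d k) h2M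
  set L := iterLog (j + 2) (m : ℝ) with hLdef
  have hL0 : 0 < L := hp _ (by omega)
  have h2 : (2 : ℝ) ^ L = iterLog (j + 1) (m : ℝ) := by
    rw [hLdef, iterLog_succ]
    exact Real.rpow_logb (by norm_num) (by norm_num) (hp _ (by omega))
  have h3 : iterLog (j + 1) (m : ℝ) ≤ 1 + ((2 : ℝ) ^ ((k : ℝ) / 2 ^ d) + d * (k + 1)) := by
    rw [iterLog_succ]
    calc Real.logb 2 (iterLog j m)
        ≤ Real.logb 2 (2 * 2 ^ ((2 : ℝ) ^ ((k : ℝ) / 2 ^ d) + d * (k + 1))) :=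
          Real.logb_le_logb_of_le (by norm_num) (hp _ (by omega))
            (h1.trans (by have := arcBound_le d k; gcongr))
      _ = _ := by
          rw [Real.logb_mul (by norm_num) (by positivity), Real.logb_self_eq_one (by norm_num),
            Real.logb_rpow (by norm_num) (by norm_num)]
  have h4 : (k : ℝ) / 2 ^ d ≤ L / 2 := by
    have hcd : c ≤ 2 ^ d / 2 := by
      rw [hc, ← Real.rpow_natCast, ← Real.rpow_sub_one (by norm_num)]
      refine Real.rpow_le_rpow_of_exponent_le (by norm_num) ?_
      have : (0 : ℝ) ≤ d := Nat.cast_nonneg d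
      linarith
    rw [div_le_iff₀ (by positivity)]
    calc (k : ℝ) ≤ c * L := hk
      _ ≤ 2 ^ d / 2 * L := by gcongr
      _ = _ := by ring
  have h5 : (2 : ℝ) ^ ((k : ℝ) / 2 ^ d) ≤ 2 ^ (L / 2) :=
    Real.rpow_le_rpow_of_exponent_le (by norm_num) h4
  have h6 : (d : ℝ) * (k + 1) ≤ d * (c * L + 1) := by gcongr
  rw [h2] at hL
  nlinarith

theorem mainTheorem7 (r σ δ : ℕ) (hr : 2 ≤ r) (hσ : 2 ≤ σ) (hδ : 1 ≤ δ) :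
    ∃ e : ℕ → ℝ, Filter.Tendsto e Filter.atTop (nhds 0) ∧
      ∀ᶠ m : ℕ in Filter.atTop, ∃ k : ℕ,
        (wGraph r m σ δ).chromaticNumber = (k : ℕ∞) ∧
        (2 : ℝ) ^ (((r : ℝ) ^ (σ + δ - 2) * ((r : ℝ) - 1) - 5) / 2) * iterLog (2 * δ) (m : ℝ) + e m
          < (k : ℝ) := by
  obtain ⟨t, rfl⟩ : ∃ t, δ = t + 1 := ⟨δ - 1, by omega⟩
  obtain ⟨d, hd⟩ : ∃ d, d + 2 = r ^ (σ + t - 1) * (r - 1) :=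
    ⟨_, Nat.sub_add_cancel (two_le_gap r σ t hr hσ)⟩
  set p := chainSize r σ (t + 1) with hp
  refine ⟨fun _ => 0, tendsto_const_nhds, ?_⟩
  filter_upwards [eventually_lt_of_le_tower (2 * t) d p, Filter.eventually_ge_atTop p] with m hm hpm
  obtain ⟨M, rfl⟩ := Nat.exists_eq_add_of_le hpm
  have := Fintype.ofFinite (wVertices r (p + M) σ (t + 1))
  have hne : (wGraph r (p + M) σ (t + 1)).chromaticNumber ≠ ⊤ :=
    SimpleGraph.chromaticNumber_ne_top_iff_exists.2
      ⟨_, (SimpleGraph.colorable_of_fintype (G := wGraph r (p + M) σ (t + 1)))⟩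
  obtain ⟨k, hk⟩ := ENat.ne_top_iff_exists.1 hne
  refine ⟨k, hk.symm, ?_⟩
  have hcol : (wGraph r (p + M) σ (t + 1)).Colorable k :=
    SimpleGraph.chromaticNumber_le_iff_colorable.1 hk.symm.le
  have hdr : (d : ℝ) + 2 = (r : ℝ) ^ (σ + (t + 1) - 2) * ((r : ℝ) - 1) := by
    have : ((d + 2 : ℕ) : ℝ) = ((r ^ (σ + t - 1) * (r - 1) : ℕ) : ℝ) := by rw [hd]
    rw [Nat.cast_mul, Nat.cast_sub (by omega)] at this
    rw [show σ + (t + 1) - 2 = σ + t - 1 by omega]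
    push_cast at this
    exact this
  rw [← hdr, add_zero]
  exact hm k M rfl (card_le_tower_of_colorable hr hσ hp.ge hd hcol)
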